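/- Let $G$ be a connected topological group, let $A$ be a compact Hausdorff abelian topological group, and let $\alpha\colon G\times A\to A$ be a (jointly) continuous action of $G$ on $A$ by topological automorphisms, that is, $\alpha$ is a continuous group action such that for every $g\in G$ the map $\alpha_g = \alpha(g,\cdot)\colon A\to A$ is a group automorphism and a homeomorphism. Then the action is trivial: $\alpha(g,a)=a$ for all $g\in G$ and $a\in A$. -/

import Mathlib

open MeasureTheory Measure ContinuousMap ComplexConjugate WeakDual
open scoped InnerProductSpace

/-! `G` acts continuously on the dual of `A`, which is discrete because `A` is compact. As `G` is
connected, every orbit map is constant, so every character kills `g • a / a`. It remains that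
characters separate points.

For this, convolution operators on `L²(A)` form a commuting star-closed family. Gelfand theory gives
an algebra character `φ` nonvanishing on the operator of `f_a - f`, where `f_a` is a translate of
`f`. Then `b ↦ φ(f_b) / φ(f)` is a character of `A` that is not `1` at `a`. -/

/-- In a C⋆-algebra, a nonzero element of a commuting star-closed set is detected by a character
of a commutative closed star-subalgebra, here the double commutant of the set. -/
theorem exists_algHom_apply_ne_zero {B : Type*} [CStarAlgebra B] (S : Set B)
    (hcomm : ∀ x ∈ S, ∀ y ∈ S, x * y = y * x) (hstar : ∀ x ∈ S, star x ∈ S) {T : B}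
    (hT : T ≠ 0) (hTS : T ∈ S) :
    ∃ (C : StarSubalgebra ℂ B) (_ : S ⊆ C) (φ : C →ₐ[ℂ] ℂ),
      Continuous φ ∧ ∃ hTC : T ∈ C, φ ⟨T, hTC⟩ ≠ 0 := by
  let C : StarSubalgebra ℂ B := (StarAlgebra.adjoin ℂ S).topologicalClosure
  have hSC : S ⊆ C :=
    (StarAlgebra.subset_adjoin ℂ S).trans (StarSubalgebra.le_topologicalClosure _)
  have hclosed : IsClosed (C : Set B) := StarSubalgebra.isClosed_topologicalClosure _
  have hadj : IsMulCommutative (StarAlgebra.adjoin ℂ S) :=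
    StarAlgebra.isMulCommutative_adjoin ℂ hcomm fun a ha b hb => hcomm a ha _ (hstar b hb)
  let : CommRing C := StarSubalgebra.commRingTopologicalClosure _ hadj.is_comm.comm
  let : CStarAlgebra C := StarSubalgebra.cstarAlgebra C (h_closed := hclosed)
  let : CommCStarAlgebra C :=
    { (inferInstance : CStarAlgebra C) with mul_comm := fun x y => mul_comm x y }
  have hne : (⟨T, hSC hTS⟩ : C) ≠ 0 := fun h => hT (congrArg Subtype.val h)
  have hg : gelfandTransform ℂ C ⟨T, hSC hTS⟩ ≠ 0 := fun h =>
    hne ((gelfandTransform_isometry C).injective (by rw [h, map_zero]))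
  obtain ⟨φ, hφ⟩ : ∃ φ, gelfandTransform ℂ C ⟨T, hSC hTS⟩ φ ≠ 0 := by
    by_contra! h
    exact hg (ContinuousMap.ext h)
  exact ⟨C, hSC, CharacterSpace.toAlgHom φ, map_continuous φ, hSC hTS, hφ⟩

theorem integral_swap_of_continuous {X : Type*} [TopologicalSpace X] [CompactSpace X]
    [MeasurableSpace X] [BorelSpace X] (μ : Measure X) [IsFiniteMeasure μ] {F : X → X → ℂ}
    (hF : Continuous F.uncurry) : ∫ x, ∫ y, F x y ∂μ ∂μ = ∫ y, ∫ x, F x y ∂μ ∂μ :=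
  integral_integral_swap_of_hasCompactSupport hF (HasCompactSupport.of_compactSpace _)

section Convolution

variable {A : Type*} [CommGroup A] [TopologicalSpace A] [IsTopologicalGroup A]

/-- The continuous family `x ↦ (y ↦ conj (f (x * y⁻¹)))`. -/
noncomputable def convKernel (f : C(A, ℂ)) : C(A, C(A, ℂ)) :=
  -- The conjugate cancels the one that the inner product puts on its first argument.
  ContinuousMap.curry ⟨fun p : A × A => conj (f (p.1 * p.2⁻¹)), by fun_prop⟩

@[simp]
theorem convKernel_apply (f : C(A, ℂ)) (x y : A) : convKernel f x y = conj (f (x * y⁻¹)) := rfl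

/-- The left translates of a continuous function. -/
noncomputable def leftTranslate (f : C(A, ℂ)) : C(A, C(A, ℂ)) :=
  ContinuousMap.curry ⟨fun p : A × A => f (p.1 * p.2), by fun_prop⟩

@[simp]
theorem leftTranslate_apply (f : C(A, ℂ)) (a x : A) : leftTranslate f a x = f (a * x) := rfl

/-- The involution `f ↦ (x ↦ conj (f x⁻¹))` of the convolution algebra. -/
noncomputable def convStar (f : C(A, ℂ)) : C(A, ℂ) := ⟨fun x => conj (f x⁻¹), by fun_prop⟩

@[simp]
theorem convStar_apply (f : C(A, ℂ)) (x : A) : convStar f x = conj (f x⁻¹) := rfl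

variable [CompactSpace A] [MeasurableSpace A] [BorelSpace A] (μ : Measure A) [IsFiniteMeasure μ]

/-- Convolution of a continuous function with a square-integrable one, as a continuous function. -/
noncomputable def convL2 : C(A, ℂ) →L[ℂ] Lp ℂ 2 μ →L[ℂ] C(A, ℂ) :=
  LinearMap.mkContinuous₂
    (LinearMap.mk₂ ℂ
      (fun f g => ⟨fun x => ⟪toLp 2 μ ℂ (convKernel f x), g⟫_ℂ, by fun_prop⟩)
      (fun f₁ f₂ g => by
        ext x
        have : convKernel (f₁ + f₂) x = convKernel f₁ x + convKernel f₂ x := by ext; simp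
        simp [this, inner_add_left])
      (fun c f g => by
        ext x
        have : convKernel (c • f) x = conj c • convKernel f x := by ext; simp
        simp [this, inner_smul_left])
      (fun f g₁ g₂ => by ext x; simp [inner_add_right])
      (fun c f g => by ext x; simp [inner_smul_right]))
    -- Cauchy–Schwarz, with `‖convKernel f x‖ ≤ ‖f‖`, gives this bound.
    ‖(toLp 2 μ ℂ : C(A, ℂ) →L[ℂ] Lp ℂ 2 μ)‖
    (fun f g => by
      refine (ContinuousMap.norm_le _ (by positivity)).2 fun x => ?_
      have hk : ‖convKernel f x‖ ≤ ‖f‖ :=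
        (ContinuousMap.norm_le _ (norm_nonneg f)).2 fun y => by
          simpa using f.norm_coe_le_norm (x * y⁻¹)
      refine (norm_inner_le_norm (𝕜 := ℂ) (toLp 2 μ ℂ (convKernel f x)) g).trans ?_
      gcongr
      exact (ContinuousLinearMap.le_opNorm _ _).trans (by gcongr))

theorem convL2_apply (f : C(A, ℂ)) (g : Lp ℂ 2 μ) (x : A) :
    convL2 μ f g x = ⟪toLp 2 μ ℂ (convKernel f x), g⟫_ℂ := rfl

theorem convL2_toLp_apply (f h : C(A, ℂ)) (x : A) :
    convL2 μ f (toLp 2 μ ℂ h) x = ∫ y, h y * f (x * y⁻¹) ∂μ := by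
  rw [convL2_apply, ContinuousMap.inner_toLp]
  simp

/-- Convolution by a continuous function, as an operator on `L²`. -/
noncomputable def convOp : C(A, ℂ) →L[ℂ] (Lp ℂ 2 μ →L[ℂ] Lp ℂ 2 μ) :=
  (ContinuousLinearMap.compL ℂ (Lp ℂ 2 μ) C(A, ℂ) (Lp ℂ 2 μ) (toLp 2 μ ℂ)) ∘L convL2 μ

theorem convOp_apply (f : C(A, ℂ)) (g : Lp ℂ 2 μ) :
    convOp μ f g = toLp 2 μ ℂ (convL2 μ f g) := rfl

theorem convL2_convL2_apply (f g h : C(A, ℂ)) (x : A) :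
    convL2 μ f (toLp 2 μ ℂ (convL2 μ g (toLp 2 μ ℂ h))) x =
      ∫ z, h z * ∫ y, g (y * z⁻¹) * f (x * y⁻¹) ∂μ ∂μ := by
  simp_rw [convL2_toLp_apply, ← integral_mul_const]
  rw [integral_swap_of_continuous μ (by unfold Function.uncurry; fun_prop)]
  simp_rw [← integral_const_mul, mul_assoc]

/-- Convolving `f` with `convStar f` gives a continuous function whose value at `1` is the integral
of `‖f y⁻¹‖ ^ 2`. -/
theorem convOp_ne_zero [μ.IsHaarMeasure] {f : C(A, ℂ)} (hf : f ≠ 0) : convOp μ f ≠ 0 := by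
  intro h
  have h0 : convL2 μ f (toLp 2 μ ℂ (convStar f)) = 0 := by
    apply ContinuousMap.toLp_injective (p := 2) (𝕜 := ℂ) μ
    rw [← convOp_apply, h]
    simp
  have h1 : convL2 μ f (toLp 2 μ ℂ (convStar f)) 1 = 0 := by rw [h0, ContinuousMap.zero_apply]
  have h2 : ∫ y, ‖f y⁻¹‖ ^ 2 ∂μ = 0 := by
    rw [convL2_toLp_apply] at h1
    simp_rw [one_mul, convStar_apply, Complex.conj_mul'] at h1
    exact_mod_cast h1
  obtain ⟨y, hy⟩ : ∃ y, f y ≠ 0 := by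
    by_contra! h
    exact hf (ContinuousMap.ext h)
  refine (Continuous.integral_pos_of_hasCompactSupport_nonneg_nonzero (μ := μ)
    (f := fun y => ‖f y⁻¹‖ ^ 2) (x := y⁻¹) (by fun_prop) (HasCompactSupport.of_compactSpace _)
    (fun y => by positivity) (by simpa using hy)).ne' h2

variable [T2Space A]

theorem convOp_ext [μ.WeaklyRegular] {S T : Lp ℂ 2 μ →L[ℂ] Lp ℂ 2 μ}
    (h : ∀ f : C(A, ℂ), S (toLp 2 μ ℂ f) = T (toLp 2 μ ℂ f)) : S = T :=
  DFunLike.coe_injective <|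
    (ContinuousMap.toLp_denseRange ℂ μ ℂ (p := 2) (by simp)).equalizer S.continuous T.continuous
      (funext h)

theorem convOp_commute [μ.IsHaarMeasure] [μ.WeaklyRegular] [μ.IsInvInvariant] (f g : C(A, ℂ)) :
    convOp μ f * convOp μ g = convOp μ g * convOp μ f := by
  refine convOp_ext μ fun h => congrArg (toLp 2 μ ℂ) (ContinuousMap.ext fun x => ?_)
  change convL2 μ _ (toLp 2 μ ℂ (convL2 μ _ _)) x = convL2 μ _ (toLp 2 μ ℂ (convL2 μ _ _)) x
  rw [convL2_convL2_apply, convL2_convL2_apply]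
  congr! 3 with z
  -- The substitution `y ↦ x * z / y` exchanges `y / z` and `x / y`.
  rw [← integral_div_left_eq_self _ μ (x * z)]
  congr! 2 with y
  rw [mul_comm]
  congr 2
  · rw [inv_div, mul_div_left_comm, mul_comm x z, div_mul_cancel_right]
  · rw [div_mul_eq_mul_div, mul_inv_cancel_right, div_eq_mul_inv]

/-- Translations pass from one convolution factor to the other. This makes the quotient `φ(f_b) /
φ(f)` multiplicative in `b`. -/
theorem convOp_leftTranslate_mul [μ.IsHaarMeasure] [μ.WeaklyRegular] (f : C(A, ℂ)) (a b : A) :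
    convOp μ (leftTranslate f a) * convOp μ (leftTranslate f b) =
      convOp μ (leftTranslate f (a * b)) * convOp μ f := by
  refine convOp_ext μ fun h => congrArg (toLp 2 μ ℂ) (ContinuousMap.ext fun x => ?_)
  change convL2 μ _ (toLp 2 μ ℂ (convL2 μ _ _)) x = convL2 μ _ (toLp 2 μ ℂ (convL2 μ _ _)) x
  rw [convL2_convL2_apply, convL2_convL2_apply]
  congr! 3 with z
  rw [← integral_mul_left_eq_self _ b⁻¹]
  simp [mul_assoc, mul_left_comm, mul_comm b]

theorem star_convOp [μ.WeaklyRegular] (f : C(A, ℂ)) :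
    star (convOp μ f) = convOp μ (convStar f) := by
  refine convOp_ext μ fun h => ?_
  refine (ContinuousMap.toLp_denseRange ℂ μ ℂ (p := 2) (by simp)).eq_of_inner_right ℂ ?_
  intro k
  rw [ContinuousLinearMap.star_eq_adjoint, ContinuousLinearMap.adjoint_inner_right, convOp_apply,
    convOp_apply, ContinuousMap.inner_toLp, ContinuousMap.inner_toLp]
  simp_rw [convL2_toLp_apply, ← integral_conj, ← integral_const_mul, ← integral_mul_const]
  rw [integral_swap_of_continuous μ (by unfold Function.uncurry; fun_prop)]
  simp [mul_comm, mul_left_comm]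

end Convolution

section Characters

variable {A : Type*} [CommGroup A] [TopologicalSpace A] [CompactSpace A]

/-- A continuous homomorphism from a compact group to `ℂ` takes values in the unit circle. -/
theorem norm_monoidHom_eq_one (χ : A →* ℂ) (hχ : Continuous χ) (a : A) : ‖χ a‖ = 1 := by
  have key : ∀ a, ‖χ a‖ ≤ 1 := fun a => by
    by_contra! h
    obtain ⟨M, hM⟩ := (isCompact_range hχ).isBounded.exists_norm_le
    obtain ⟨n, hn⟩ := pow_unbounded_of_one_lt M h
    refine hn.not_ge ?_
    rw [← norm_pow, ← map_pow]
    exact hM _ ⟨_, rfl⟩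
  refine (key a).antisymm ?_
  have h1 : ‖χ a‖ * ‖χ a⁻¹‖ = 1 := by rw [← norm_mul, ← map_mul]; simp
  nlinarith [key a, key a⁻¹, norm_nonneg (χ a)]

/-- A continuous homomorphism from a compact group to `ℂ`, as an element of the dual. -/
noncomputable def PontryaginDual.ofComplex (χ : A →* ℂ) (hχ : Continuous χ) : PontryaginDual A :=
  show A →ₜ* Circle from
  { toFun := fun a => ⟨χ a, mem_sphere_zero_iff_norm.2 (norm_monoidHom_eq_one χ hχ a)⟩
    map_one' := Subtype.ext χ.map_one
    map_mul' := fun a b => Subtype.ext (χ.map_mul a b)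
    continuous_toFun := hχ.subtype_mk _ }

theorem PontryaginDual.coe_ofComplex (χ : A →* ℂ) (hχ : Continuous χ) (a : A) :
    (PontryaginDual.ofComplex χ hχ a : ℂ) = χ a := rfl

variable [IsTopologicalGroup A] [T2Space A]

/-- The characters of a compact Hausdorff abelian group separate points. -/
theorem PontryaginDual.exists_apply_ne_one {a : A} (ha : a ≠ 1) :
    ∃ χ : PontryaginDual A, χ a ≠ 1 := by
  let : MeasurableSpace A := borel A
  have : BorelSpace A := ⟨rfl⟩
  let μ : Measure A := haar
  -- With `u 1 = 0` and `u a = 1`, the difference `f_a - f` is nonzero at `1`.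
  obtain ⟨u, hu1, hua, -⟩ := exists_continuous_zero_one_of_isClosed
    (isClosed_singleton (x := (1 : A))) (isClosed_singleton (x := a))
    (Set.disjoint_singleton.2 ha.symm)
  let f : C(A, ℂ) := ⟨fun x => (u x : ℂ), by fun_prop⟩
  have hf : leftTranslate f a - f ≠ 0 := fun h => by
    have := congr($h 1)
    have h1 : u 1 = 0 := hu1 rfl
    have h2 : u a = 1 := hua rfl
    simp [f, h1, h2] at this
  obtain ⟨C, hC, φ, hφ, hTC, hne⟩ := exists_algHom_apply_ne_zero (Set.range (convOp μ))
    (by rintro _ ⟨f, rfl⟩ _ ⟨g, rfl⟩; exact convOp_commute μ f g)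
    (by rintro _ ⟨f, rfl⟩; exact ⟨_, (star_convOp μ f).symm⟩)
    (convOp_ne_zero μ hf) ⟨_, rfl⟩
  let ψ : C(A, ℂ) → ℂ := fun g => φ ⟨convOp μ g, hC ⟨g, rfl⟩⟩
  have hψ : Continuous ψ := hφ.comp ((convOp μ).continuous.subtype_mk _)
  have hψmul : ∀ a b, ψ (leftTranslate f a) * ψ (leftTranslate f b) =
      ψ (leftTranslate f (a * b)) * ψ f := fun a b => by
    refine (_root_.map_mul φ _ _).symm.trans (Eq.trans (congrArg φ ?_) (_root_.map_mul φ _ _))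
    exact Subtype.ext (convOp_leftTranslate_mul μ f a b)
  have hψsub : ψ (leftTranslate f a) - ψ f ≠ 0 := by
    refine fun h => hne (Eq.trans (congrArg φ ?_) ((map_sub φ _ _).trans h))
    exact Subtype.ext (map_sub (convOp μ) _ _)
  -- If `ψ f = 0`, then `ψ(f_a)² = ψ(f_{a²}) ψ(f) = 0`, against `hψsub`.
  have hψf : ψ f ≠ 0 := fun h => by
    have := hψmul a a
    rw [h, mul_zero, mul_self_eq_zero] at this
    exact hψsub (by rw [this, h, sub_zero])
  have hone : leftTranslate f 1 = f := by ext; simp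
  let χ : A →* ℂ :=
    { toFun := fun a => ψ (leftTranslate f a) / ψ f
      map_one' := by rw [hone, div_self hψf]
      map_mul' := fun a b => by
        rw [div_mul_div_comm, hψmul, mul_div_mul_right _ _ hψf] }
  have hχ : Continuous χ := (hψ.comp (leftTranslate f).continuous).div_const _
  refine ⟨.ofComplex χ hχ, fun h => hψsub ?_⟩
  have h1 : χ a = 1 := by rw [← PontryaginDual.coe_ofComplex χ hχ, h, Circle.coe_one]
  exact sub_eq_zero.2 ((div_eq_one_iff_eq hψf).1 h1)

end Characters

theorem lemma4p1 {G : Type*} {A : Type*}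
    [Group G] [TopologicalSpace G] [IsTopologicalGroup G] [ConnectedSpace G]
    [CommGroup A] [TopologicalSpace A] [IsTopologicalGroup A] [CompactSpace A] [T2Space A]
    [MulDistribMulAction G A] [ContinuousSMul G A] :
    ∀ (g : G) (a : A), g • a = a := by
  intro g a
  by_contra h
  obtain ⟨χ, hχ⟩ := PontryaginDual.exists_apply_ne_one (mt div_eq_one.1 h)
  let F : G → PontryaginDual A := fun g => PontryaginDual.map
    { MulDistribMulAction.toMonoidHom A g with continuous_toFun := continuous_const_smul g } χ
  have hF : Continuous F := ContinuousMonoidHom.continuous_of_continuous_uncurry _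
    ((map_continuous χ).comp (continuous_fst.smul continuous_snd))
  -- The dual of a compact group is discrete, so `F` is constant.
  have hχa : χ (g • a) = χ ((1 : G) • a) :=
    DFunLike.congr_fun (PreconnectedSpace.constant inferInstance hF (x := g) (y := 1)) a
  refine hχ ?_
  rw [map_div, hχa, one_smul, div_self']
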